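/- \textbf{The cat/dog game with quantum coins.} \emph{Games.} A two-player game of private information has strategy sets $S_1,S_2$, finite signal sets $\mathcal A_1,\mathcal A_2$, a probability distribution $\nu$ on $\mathcal A_1\times\mathcal A_2$ and payoffs $P_i:\mathcal A_1\times\mathcal A_2\times S_1\times S_2\to\mathbb R$. Its associated game $G^\#$ has strategy sets $\mathrm{Hom}(\mathcal A_i,S_i)$ and payoffs $P_i^\#(F_1,F_2)=\sum_{(a,b)}\nu(a,b)\,P_i(a,b,F_1(a),F_2(b))$. In the cat/dog game $G$, $S_1=S_2=\{H,T\}$ ($H$ = "yes", $T$ = "no"), $\mathcal A_1=\mathcal A_2=\{C,D\}$ (the "cat" and "dog" questions), and $\nu$ is uniform. The players win if their answers agree, unless both receive $C$, in which case they win if and only if their answers differ. Both payoffs are $1$ if the players win and $0$ otherwise. \emph{Quantum strategies.} Let $\xi=HH+TT$, in the complex vector space with basis $HH,HT,TH,TT$. A quantum strategy is either a unitary $2\times2$ matrix (apply it to one's coin, then play the face that is observed) or a pure strategy in $\{H,T\}$ (throw one's coin away and play that face). If the players choose unitaries $U,V$, the pair $(s,t)$ is played with probability proportional to the squared modulus of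 the coefficient of $(U\otimes V)\xi$ on $st$. If exactly one player chooses a pure strategy, he plays it, and the face played by the other is drawn from the marginal distribution of the other's coin (the pure player's coin being left untransformed and its face ignored). If both choose pure strategies, these are played. Replacing $\{H,T\}$ by the set of quantum strategies, and payoffs by expected payoffs, gives the game of private information $G(\xi)$, hence the full quantum game $G(\xi)^\#$. Let $G(\xi)^\#_0$ be its restriction to strategies with values in special unitary matrices. A profile is Pareto optimal if no other profile of the game in question makes both players at least as well off and one of them strictly better off. \emph{Profiles.} For $\theta\in\mathbb R$ put $M(\theta)=\begin{pmatrix}\cos\theta&\sin\theta\\-\sin\theta&\cos\theta\end{pmatrix}$ and consider the profile $$U_C=M(-\theta),\quad U_D=M(\theta),\quad V_C=M(2\theta),\quad V_D=M(0),\qquad(*)$$ where Player One plays $U_a$ on signal $a$ and Player Two plays $V_b$ on signal $b$. \emph{Claims.} (1) For every real $\theta$, each player's payoff at $(*)$ is $\tfrac14\sin^2(3\theta)+\tfrac34\cos^2\theta$, and this expression is maximal at $\theta=\pi/8$. (2) The profile $(*)$ with $\theta=\pi/8$ is a Pareto optimal Nash equilibrium of $G(\xi)^\#_0$. (3) It is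 also a Pareto optimal Nash equilibrium of the full quantum game $G(\xi)^\#$. (4) At this profile the players win with probability $\cos^2(\pi/8)$, both overall and conditionally on each of the four question pairs, and $|\cos^2(\pi/8)-0.85|<0.005$. (5) In every classical correlated equilibrium of $G^\#$ (a probability distribution on pairs of maps $\{C,D\}\to\{H,T\}$ such that no player can gain by replacing the map recommended to him by a function of it), the expected payoff of each player is at most $3/4$. -/

import Mathlib

namespace QGame

/-! ### Two-player games -/

/-- A two-player game with strategy sets `S₁`, `S₂`, given by its two payoff functions. -/
structure Game (S₁ S₂ : Type*) where
  payoff₁ : S₁ → S₂ → ℝ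
  payoff₂ : S₁ → S₂ → ℝ

namespace Game

variable {S₁ S₂ : Type*}

/-- Nash equilibrium (deviation-proofness). -/
def IsNash (G : Game S₁ S₂) (s : S₁) (t : S₂) : Prop :=
  (∀ s' : S₁, G.payoff₁ s' t ≤ G.payoff₁ s t) ∧
    (∀ t' : S₂, G.payoff₂ s t' ≤ G.payoff₂ s t)

/-- No strategy pair makes both players at least as well off and one of them better off. -/
def IsParetoOptimal (G : Game S₁ S₂) (s : S₁) (t : S₂) : Prop :=
  ¬ ∃ (s' : S₁) (t' : S₂),
    G.payoff₁ s t ≤ G.payoff₁ s' t' ∧ G.payoff₂ s t ≤ G.payoff₂ s' t' ∧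
      (G.payoff₁ s t < G.payoff₁ s' t' ∨ G.payoff₂ s t < G.payoff₂ s' t')

variable [Fintype S₁] [Fintype S₂]

/-- Expected payoff of Player One when strategy pairs are drawn according to `μ`. -/
noncomputable def expectedPayoff₁ (G : Game S₁ S₂) (μ : S₁ × S₂ → ℝ) : ℝ :=
  ∑ p, μ p * G.payoff₁ p.1 p.2

/-- Expected payoff of Player Two when strategy pairs are drawn according to `μ`. -/
noncomputable def expectedPayoff₂ (G : Game S₁ S₂) (μ : S₁ × S₂ → ℝ) : ℝ :=
  ∑ p, μ p * G.payoff₂ p.1 p.2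

/-- `μ` is a correlated equilibrium (Aumann): a probability distribution on strategy pairs such
that no player gains by replacing the strategy recommended to him by a function of it. -/
def IsCorrelatedEquilibrium (G : Game S₁ S₂) (μ : S₁ × S₂ → ℝ) : Prop :=
  μ ∈ stdSimplex ℝ (S₁ × S₂) ∧
    (∀ f : S₁ → S₁, ∑ p, μ p * G.payoff₁ (f p.1) p.2 ≤ G.expectedPayoff₁ μ) ∧
    (∀ g : S₂ → S₂, ∑ p, μ p * G.payoff₂ p.1 (g p.2) ≤ G.expectedPayoff₂ μ)

end Game

/-! ### Games of private information -/

/-- A two-player game of private information with finite signal sets `A₁`, `A₂` and strategy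
sets `S₁`, `S₂`: a probability distribution on signal pairs, and payoffs that depend on the
signal pair and on the strategy pair. -/
structure PrivateGame (A₁ A₂ S₁ S₂ : Type*) [Fintype A₁] [Fintype A₂] where
  prior : A₁ × A₂ → ℝ
  prior_mem : prior ∈ stdSimplex ℝ (A₁ × A₂)
  payoff₁ : A₁ → A₂ → S₁ → S₂ → ℝ
  payoff₂ : A₁ → A₂ → S₁ → S₂ → ℝ

/-- The associated game `G^#`: strategies are maps from signals to strategies, and payoffs are
expectations over the signal pair. -/
noncomputable def PrivateGame.sharp {A₁ A₂ S₁ S₂ : Type*} [Fintype A₁] [Fintype A₂]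
    (G : PrivateGame A₁ A₂ S₁ S₂) : Game (A₁ → S₁) (A₂ → S₂) where
  payoff₁ F₁ F₂ := ∑ a, G.prior a * G.payoff₁ a.1 a.2 (F₁ a.1) (F₂ a.2)
  payoff₂ F₁ F₂ := ∑ a, G.prior a * G.payoff₂ a.1 a.2 (F₁ a.1) (F₂ a.2)

/-! ### Quantum coins -/

/-- The two faces of a coin, which are also the two pure strategies of each player. -/
abbrev Face : Type := Fin 2

/-- Heads. -/
abbrev H : Face := 0

/-- Tails. -/
abbrev T : Face := 1

/-- A quantum environment: a non-zero vector in the complex vector space with basis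
`HH, HT, TH, TT`. -/
structure QEnv where
  state : Face × Face → ℂ
  ne_zero : state ≠ 0

/-- The environment `HH + TT`. -/
noncomputable def maxEntangled : QEnv where
  state := Pi.single (H, H) 1 + Pi.single (T, T) 1
  ne_zero := by
    intro h
    have := congrFun h (H, H)
    simp at this

/-- The strategies available to a player holding one of the two coins: apply a unitary
transformation to the coin, observe it and play the observed face; or throw the coin away
and play a pure strategy. -/
inductive QStrategy
  | observe (U : Matrix.unitaryGroup Face ℂ)
  | pure (s : Face)

/-- The state of the pair of coins after Player One applies `U` to the first coin and
Player Two applies `V` to the second coin. -/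
noncomputable def QEnv.apply (ξ : QEnv) (U V : Matrix.unitaryGroup Face ℂ) :
    Face × Face → ℂ :=
  (Matrix.kronecker U.1 V.1).mulVec ξ.state

/-- The probability that the two coins, after `U` and `V` are applied, show the pair of faces
`p`: it is proportional to the squared modulus of the coefficient on `p`. -/
noncomputable def QEnv.born (ξ : QEnv) (U V : Matrix.unitaryGroup Face ℂ) (p : Face × Face) :
    ℝ :=
  ‖ξ.apply U V p‖ ^ 2 / ∑ q, ‖ξ.apply U V q‖ ^ 2

/-- The probability distribution on pairs of pure strategies imposed by a pair of quantum
strategies. If one player plays a pure strategy, the face of his (discarded) coin is ignored,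
and the other player's coin shows a face according to its marginal distribution. -/
noncomputable def QEnv.outcome (ξ : QEnv) : QStrategy → QStrategy → Face × Face → ℝ
  | .observe U, .observe V, p => ξ.born U V p
  | .observe U, .pure t, p => if p.2 = t then ∑ j, ξ.born U 1 (p.1, j) else 0
  | .pure s, .observe V, p => if p.1 = s then ∑ i, ξ.born 1 V (i, p.2) else 0
  | .pure s, .pure t, p => if p = (s, t) then 1 else 0

/-- A special unitary matrix viewed as a quantum strategy. -/
def QStrategy.ofSpecial (U : Matrix.specialUnitaryGroup Face ℂ) : QStrategy :=
  .observe ⟨U.1, Matrix.specialUnitaryGroup_le_unitaryGroup U.2⟩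

section Quantum

variable {A₁ A₂ : Type*} [Fintype A₁] [Fintype A₂]

/-- The game of private information `G(ξ)`, in which each player chooses a quantum strategy. -/
noncomputable def PrivateGame.quantum (G : PrivateGame A₁ A₂ Face Face) (ξ : QEnv) :
    PrivateGame A₁ A₂ QStrategy QStrategy where
  prior := G.prior
  prior_mem := G.prior_mem
  payoff₁ a b U V := ∑ p, ξ.outcome U V p * G.payoff₁ a b p.1 p.2
  payoff₂ a b U V := ∑ p, ξ.outcome U V p * G.payoff₂ a b p.1 p.2

/-- The restriction of `G(ξ)` in which each player must choose a special unitary matrix. -/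
noncomputable def PrivateGame.quantumSpecial (G : PrivateGame A₁ A₂ Face Face) (ξ : QEnv) :
    PrivateGame A₁ A₂ (Matrix.specialUnitaryGroup Face ℂ) (Matrix.specialUnitaryGroup Face ℂ)
    where
  prior := G.prior
  prior_mem := G.prior_mem
  payoff₁ a b U V := (G.quantum ξ).payoff₁ a b (.ofSpecial U) (.ofSpecial V)
  payoff₂ a b U V := (G.quantum ξ).payoff₂ a b (.ofSpecial U) (.ofSpecial V)

end Quantum

/-! ### The rotation strategies -/

/-- The matrix of `M(θ)`. -/
noncomputable def rotationMatrix (θ : ℝ) : Matrix Face Face ℂ :=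
  !![(Real.cos θ : ℂ), (Real.sin θ : ℂ); -(Real.sin θ : ℂ), (Real.cos θ : ℂ)]

theorem rotationMatrix_mem (θ : ℝ) :
    rotationMatrix θ ∈ Matrix.specialUnitaryGroup Face ℂ := by
  have h : (Real.cos θ : ℂ) * Real.cos θ + (Real.sin θ : ℂ) * Real.sin θ = 1 := by
    norm_cast
    nlinarith [Real.sin_sq_add_cos_sq θ]
  rw [Matrix.mem_specialUnitaryGroup_iff, Matrix.mem_unitaryGroup_iff]
  refine ⟨?_, ?_⟩
  · ext i j
    fin_cases i <;> fin_cases j <;>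
      simp [rotationMatrix, Matrix.mul_apply, Matrix.star_apply, Fin.sum_univ_two,
        -Complex.ofReal_cos, -Complex.ofReal_sin]
    · exact h
    · ring
    · ring
    · rw [add_comm]; exact h
  · rw [rotationMatrix, Matrix.det_fin_two_of, mul_neg, sub_neg_eq_add]
    exact h

/-- `M(θ)` as a special unitary matrix. -/
noncomputable def M (θ : ℝ) : Matrix.specialUnitaryGroup Face ℂ :=
  ⟨rotationMatrix θ, rotationMatrix_mem θ⟩

/-! ### The cat/dog game -/

/-- The two questions, which are the signals of the cat/dog game. -/
inductive Question
  | cat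
  | dog
  deriving DecidableEq

instance : Fintype Question where
  elems := {.cat, .dog}
  complete q := by cases q <;> simp

/-- The players win if their answers agree, unless both get the cat question, in which case
they win if their answers disagree. The answers are the faces `H` (yes) and `T` (no). -/
def Wins (a b : Question) (s t : Face) : Prop :=
  if a = .cat ∧ b = .cat then s ≠ t else s = t

instance (a b : Question) (s t : Face) : Decidable (Wins a b s t) := by
  unfold Wins; infer_instance

/-- The cat/dog game: the questions are drawn by independent fair coin flips, and each player
gets `1` if the players win and `0` otherwise. -/
noncomputable def catDog : PrivateGame Question Question Face Face where
  prior _ := 1 / 4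
  prior_mem := by
    refine ⟨fun _ => by norm_num, ?_⟩
    rw [Finset.sum_const, Finset.card_univ, show Fintype.card (Question × Question) = 4 from rfl]
    norm_num
  payoff₁ a b s t := if Wins a b s t then 1 else 0
  payoff₂ a b s t := if Wins a b s t then 1 else 0

/-- Player One's strategy `U_C = M(-θ)`, `U_D = M(θ)`. -/
noncomputable def playerOne (θ : ℝ) : Question → Matrix.specialUnitaryGroup Face ℂ
  | .cat => M (-θ)
  | .dog => M θ

/-- Player Two's strategy `V_C = M(2θ)`, `V_D = M(0)`. -/
noncomputable def playerTwo (θ : ℝ) : Question → Matrix.specialUnitaryGroup Face ℂ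
  | .cat => M (2 * θ)
  | .dog => M 0

/-- The strategy of Player One in the full quantum game. -/
noncomputable def playerOneFull (θ : ℝ) (a : Question) : QStrategy := .ofSpecial (playerOne θ a)

/-- The strategy of Player Two in the full quantum game. -/
noncomputable def playerTwoFull (θ : ℝ) (b : Question) : QStrategy := .ofSpecial (playerTwo θ b)

/-- The probability that the players win, conditionally on the question pair `(a, b)`, when they
play `σ` and `τ` in the environment `ξ`. -/
noncomputable def condWinProb (ξ : QEnv) (σ τ : Question → QStrategy) (a b : Question) : ℝ :=
  ∑ p : Face × Face with Wins a b p.1 p.2, ξ.outcome (σ a) (τ b) p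

/-- The overall probability that the players win. -/
noncomputable def winProb (ξ : QEnv) (σ τ : Question → QStrategy) : ℝ :=
  ∑ q, catDog.prior q * condWinProb ξ σ τ q.1 q.2

end QGame

open QGame

open QGame

namespace QGame

/-! ### Outcome probabilities in terms of Bloch vectors -/

/-! Winning probabilities here are governed by Tsirelson's inequality. Each quantum strategy is
encoded by a unit vector in ℝ⁴ (three Bloch coordinates and one for pure play) so that the answers
agree with probability `(1 + c) / 2`, with `c` a fixed bilinear form in the two vectors. The overall
winning probability is then `1/2` plus an eighth of a CHSH expression, which completing squares
bounds by `2√2`.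

At `θ = π/8` the rotation profile attains this bound, even against strategies that discard the coin.
Both players receive the winning probability, so a global maximiser is a Pareto optimal Nash
equilibrium, in the restricted game as well. Classically, every deterministic profile loses on some
question pair, so averaging gives at most `3/4`. -/

theorem normSq_of_mem_unitaryGroup {W : Matrix Face Face ℂ}
    (hW : W ∈ Matrix.unitaryGroup Face ℂ) :
    ‖W 0 0‖ ^ 2 + ‖W 0 1‖ ^ 2 = 1 ∧ ‖W 1 0‖ ^ 2 + ‖W 1 1‖ ^ 2 = 1 ∧
      ‖W 0 0‖ ^ 2 + ‖W 1 0‖ ^ 2 = 1 := by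
  have h₁ := Matrix.mem_unitaryGroup_iff.mp hW
  have h₂ := Matrix.mem_unitaryGroup_iff'.mp hW
  have h00 := congrArg Complex.re (congrFun (congrFun h₁ 0) 0)
  have h11 := congrArg Complex.re (congrFun (congrFun h₁ 1) 1)
  have h00' := congrArg Complex.re (congrFun (congrFun h₂ 0) 0)
  simp only [Matrix.mul_apply, Fin.sum_univ_two, Matrix.star_apply, Complex.add_re,
    Complex.mul_re, RCLike.star_def, Complex.conj_re, Complex.conj_im, Matrix.one_apply_eq,
    Complex.one_re] at h00 h11 h00'
  simp only [← Complex.normSq_eq_norm_sq, Complex.normSq_apply]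
  exact ⟨by linarith, by linarith, by linarith⟩

/-- Read as a 2×2 matrix, `HH + TT` is the identity, and `U ⊗ V` sends a matrix `X` to `U X Vᵀ`. -/
theorem maxEntangled_apply (U V : Matrix.unitaryGroup Face ℂ) (p : Face × Face) :
    maxEntangled.apply U V p = (U.1 * V.1.transpose) p.1 p.2 := by
  obtain ⟨i, j⟩ := p
  simp [QEnv.apply, maxEntangled, Matrix.mulVec, dotProduct, Fintype.sum_prod_type,
    Matrix.mul_apply, Pi.single_apply, Fin.sum_univ_two]

theorem mul_transpose_mem_unitaryGroup (U V : Matrix.unitaryGroup Face ℂ) :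
    U.1 * V.1.transpose ∈ Matrix.unitaryGroup Face ℂ := by
  refine mul_mem U.2 ?_
  have h := Matrix.mem_unitaryGroup_iff'.mp V.2
  rw [Matrix.mem_unitaryGroup_iff, Matrix.star_eq_conjTranspose] at *
  have h' := congrArg Matrix.transpose h
  rw [Matrix.transpose_mul, Matrix.transpose_one] at h'
  exact h'

theorem maxEntangled_born (U V : Matrix.unitaryGroup Face ℂ) (p : Face × Face) :
    maxEntangled.born U V p = ‖(U.1 * V.1.transpose) p.1 p.2‖ ^ 2 / 2 := by
  obtain ⟨h₀, h₁, -⟩ := normSq_of_mem_unitaryGroup (mul_transpose_mem_unitaryGroup U V)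
  have : ∑ q, ‖maxEntangled.apply U V q‖ ^ 2 = 2 := by
    simp only [maxEntangled_apply, Fintype.sum_prod_type, Fin.sum_univ_two]
    linarith
  rw [QEnv.born, this, maxEntangled_apply]

/-- A unit vector attached to a quantum strategy: the Bloch vector of the first row of a unitary
matrix, with a further coordinate that carries the pure strategies. -/
noncomputable def blochVector : QStrategy → Fin 4 → ℝ
  | .observe U => ![‖U.1 0 0‖ ^ 2 - ‖U.1 0 1‖ ^ 2, 2 * (U.1 0 0 * star (U.1 0 1)).re,
      2 * (U.1 0 0 * star (U.1 0 1)).im, 0]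
  | .pure s => ![0, 0, 0, if s = H then 1 else -1]

/-- The correlation of the faces played with the maximally entangled coins. -/
noncomputable def correlation (σ τ : QStrategy) : ℝ :=
  blochVector σ 0 * blochVector τ 0 + blochVector σ 1 * blochVector τ 1 -
    blochVector σ 2 * blochVector τ 2 + blochVector σ 3 * blochVector τ 3

theorem sum_sq_blochVector (σ : QStrategy) :
    blochVector σ 0 ^ 2 + blochVector σ 1 ^ 2 + blochVector σ 2 ^ 2 + blochVector σ 3 ^ 2 = 1 := by
  cases σ with
  | observe U =>
    obtain ⟨h, -, -⟩ := normSq_of_mem_unitaryGroup U.2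
    simp only [blochVector, Matrix.cons_val, ← Complex.normSq_eq_norm_sq, Complex.normSq_apply,
      Complex.mul_re, Complex.mul_im, RCLike.star_def, Complex.conj_re, Complex.conj_im] at h ⊢
    -- With `N` the squared norm of the first row, the left side is `N²`, and `N² - 1 = (N + 1)(N -
    -- 1)`.
    linear_combination ((U.1 0 0).re * (U.1 0 0).re + (U.1 0 0).im * (U.1 0 0).im +
      ((U.1 0 1).re * (U.1 0 1).re + (U.1 0 1).im * (U.1 0 1).im) + 1) * h
  | pure s => by_cases hs : s = H <;> simp [blochVector, hs]

/-- The entry pairs the first rows of `U` and `V` without conjugation, that is, it is a Hermitian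
product with the conjugate row. Conjugation flips the imaginary Bloch coordinate, hence the minus
sign in `correlation`. -/
theorem norm_sq_mul_transpose_apply (U V : Matrix.unitaryGroup Face ℂ) :
    ‖(U.1 * V.1.transpose) 0 0‖ ^ 2 =
      (1 + correlation (.observe U) (.observe V)) / 2 := by
  obtain ⟨hU, -, -⟩ := normSq_of_mem_unitaryGroup U.2
  obtain ⟨hV, -, -⟩ := normSq_of_mem_unitaryGroup V.2
  simp only [correlation, blochVector, Matrix.cons_val, ← Complex.normSq_eq_norm_sq,
    Complex.normSq_apply, Matrix.mul_apply, Fin.sum_univ_two, Matrix.transpose_apply,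
    Complex.mul_re, Complex.mul_im, Complex.add_re, Complex.add_im, RCLike.star_def,
    Complex.conj_re, Complex.conj_im] at hU hV ⊢
  linear_combination (1 / 2 : ℝ) * hU + (1 / 2 : ℝ) * ((U.1 0 0).re * (U.1 0 0).re +
    (U.1 0 0).im * (U.1 0 0).im + ((U.1 0 1).re * (U.1 0 1).re + (U.1 0 1).im * (U.1 0 1).im)) * hV

/-- In a 2×2 unitary matrix, opposite entries have equal modulus, so one entry determines all
probabilities. If exactly one player plays a pure strategy, the other coin is uniform, matching the
orthogonality of the two vectors. -/
theorem outcome_agree_and_disagree (σ τ : QStrategy) :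
    maxEntangled.outcome σ τ (0, 0) + maxEntangled.outcome σ τ (1, 1) =
        (1 + correlation σ τ) / 2 ∧
      maxEntangled.outcome σ τ (0, 1) + maxEntangled.outcome σ τ (1, 0) =
        (1 - correlation σ τ) / 2 := by
  cases σ with
  | observe U =>
    cases τ with
    | observe V =>
      obtain ⟨h₀, h₁, h₂⟩ := normSq_of_mem_unitaryGroup (mul_transpose_mem_unitaryGroup U V)
      have h := norm_sq_mul_transpose_apply U V
      simp only [QEnv.outcome, maxEntangled_born]
      constructor <;> linarith
    | pure t =>
      obtain ⟨h₀, h₁, h₂⟩ := normSq_of_mem_unitaryGroup (mul_transpose_mem_unitaryGroup U 1)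
      fin_cases t <;>
        simp only [QEnv.outcome, maxEntangled_born, correlation, blochVector, Fin.sum_univ_two,
          Matrix.cons_val] <;> constructor <;> simp <;> simp at h₀ h₁ h₂ <;> linarith
  | pure s =>
    cases τ with
    | observe V =>
      obtain ⟨h₀, h₁, h₂⟩ := normSq_of_mem_unitaryGroup (mul_transpose_mem_unitaryGroup 1 V)
      fin_cases s <;>
        simp only [QEnv.outcome, maxEntangled_born, correlation, blochVector, Fin.sum_univ_two,
          Matrix.cons_val] <;> constructor <;> simp <;> simp at h₀ h₁ h₂ <;> linarith
    | pure t =>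
      fin_cases s <;> fin_cases t <;> simp [QEnv.outcome, correlation, blochVector]

/-! ### The winning probability -/

theorem condWinProb_maxEntangled (σ τ : Question → QStrategy) (a b : Question) :
    condWinProb maxEntangled σ τ a b =
      if a = .cat ∧ b = .cat then (1 - correlation (σ a) (τ b)) / 2
      else (1 + correlation (σ a) (τ b)) / 2 := by
  obtain ⟨h₁, h₂⟩ := outcome_agree_and_disagree (σ a) (τ b)
  rw [condWinProb, Finset.sum_filter]
  cases a <;> cases b <;> simp [Wins, Fintype.sum_prod_type, Fin.sum_univ_two] <;> linarith

theorem sum_question_prod (f : Question × Question → ℝ) :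
    ∑ q, f q = f (.cat, .cat) + f (.cat, .dog) + f (.dog, .cat) + f (.dog, .dog) := by
  have h : ∀ g : Question → ℝ, ∑ a, g a = g .cat + g .dog := fun g =>
    Finset.sum_pair (by decide)
  rw [Fintype.sum_prod_type]
  simp only [h]
  ring

theorem winProb_maxEntangled (σ τ : Question → QStrategy) :
    winProb maxEntangled σ τ = 1 / 2 + 1 / 8 *
      (correlation (σ .cat) (τ .dog) - correlation (σ .cat) (τ .cat) +
        correlation (σ .dog) (τ .cat) + correlation (σ .dog) (τ .dog)) := by
  simp [winProb, sum_question_prod, condWinProb_maxEntangled, catDog]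
  ring

theorem sharp_quantum_payoff₁ (ξ : QEnv) (σ τ : Question → QStrategy) :
    (catDog.quantum ξ).sharp.payoff₁ σ τ = winProb ξ σ τ := by
  simp [PrivateGame.sharp, PrivateGame.quantum, winProb, condWinProb, Finset.sum_filter, catDog]

theorem sharp_quantum_payoff₂ (ξ : QEnv) (σ τ : Question → QStrategy) :
    (catDog.quantum ξ).sharp.payoff₂ σ τ = winProb ξ σ τ := by
  simp [PrivateGame.sharp, PrivateGame.quantum, winProb, condWinProb, Finset.sum_filter, catDog]

/-- Tsirelson's bound for the cat/dog game. -/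
theorem winProb_maxEntangled_le (σ τ : Question → QStrategy) :
    winProb maxEntangled σ τ ≤ 1 / 2 + √2 / 4 := by
  rw [winProb_maxEntangled]
  have key : ∀ x y u v : Fin 4 → ℝ,
      x 0 ^ 2 + x 1 ^ 2 + x 2 ^ 2 + x 3 ^ 2 = 1 → y 0 ^ 2 + y 1 ^ 2 + y 2 ^ 2 + y 3 ^ 2 = 1 →
      u 0 ^ 2 + u 1 ^ 2 + u 2 ^ 2 + u 3 ^ 2 = 1 → v 0 ^ 2 + v 1 ^ 2 + v 2 ^ 2 + v 3 ^ 2 = 1 →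
      x 0 * (v 0 - u 0) + x 1 * (v 1 - u 1) - x 2 * (v 2 - u 2) + x 3 * (v 3 - u 3) +
        (y 0 * (v 0 + u 0) + y 1 * (v 1 + u 1) - y 2 * (v 2 + u 2) + y 3 * (v 3 + u 3)) ≤
        2 * √2 := by
    intro x y u v hx hy hu hv
    have h2 : √2 ^ 2 = 2 := Real.sq_sqrt (by norm_num)
    have hpos : 0 < √2 := by positivity
    -- In the optimal case `√2 x` and `√2 y` equal `v - u` and `v + u`, up to the sign of the third
    -- coordinate. Expanding uses `|v - u|² + |v + u|² = 4`.
    have hs : 0 ≤ (√2 * x 0 - (v 0 - u 0)) ^ 2 + (√2 * x 1 - (v 1 - u 1)) ^ 2 +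
        (√2 * x 2 + (v 2 - u 2)) ^ 2 + (√2 * x 3 - (v 3 - u 3)) ^ 2 +
        ((√2 * y 0 - (v 0 + u 0)) ^ 2 + (√2 * y 1 - (v 1 + u 1)) ^ 2 +
        (√2 * y 2 + (v 2 + u 2)) ^ 2 + (√2 * y 3 - (v 3 + u 3)) ^ 2) := by positivity
    refine le_of_mul_le_mul_left ?_ hpos
    linear_combination (1 / 2 : ℝ) * hs + hu + hv + (1 / 2 : ℝ) * √2 ^ 2 * hx +
      (1 / 2 : ℝ) * √2 ^ 2 * hy - h2
  have h := key _ _ _ _ (sum_sq_blochVector (σ .cat)) (sum_sq_blochVector (σ .dog))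
    (sum_sq_blochVector (τ .cat)) (sum_sq_blochVector (τ .dog))
  simp only [correlation]
  linarith

/-! ### The rotation profile -/

/-- The vector of `M(α)` is `(cos 2α, sin 2α, 0, 0)`, so the correlation is `cos 2(α - β)`. -/
theorem correlation_rotation (α β : ℝ) :
    correlation (.ofSpecial (M α)) (.ofSpecial (M β)) = 2 * Real.cos (α - β) ^ 2 - 1 := by
  rw [← Real.cos_two_mul, show 2 * (α - β) = 2 * α - 2 * β by ring, Real.cos_sub]
  simp only [Real.cos_two_mul', Real.sin_two_mul]
  simp [correlation, blochVector, QStrategy.ofSpecial, M, rotationMatrix,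
    -Complex.ofReal_cos, -Complex.ofReal_sin]
  ring

theorem condWinProb_rotation (θ : ℝ) (a b : Question) :
    condWinProb maxEntangled (playerOneFull θ) (playerTwoFull θ) a b =
      if a = .cat ∧ b = .cat then Real.sin (3 * θ) ^ 2 else Real.cos θ ^ 2 := by
  rw [condWinProb_maxEntangled]
  cases a <;> cases b <;>
    simp only [playerOneFull, playerTwoFull, playerOne, playerTwo, correlation_rotation,
      reduceCtorEq, and_self, and_true, and_false, if_true, if_false]
  · rw [show -θ - 2 * θ = -(3 * θ) by ring, Real.cos_neg, Real.sin_sq]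
    ring
  · rw [sub_zero, Real.cos_neg]
    ring
  · rw [show θ - 2 * θ = -θ by ring, Real.cos_neg]
    ring
  · rw [sub_zero]
    ring

theorem winProb_rotation (θ : ℝ) :
    winProb maxEntangled (playerOneFull θ) (playerTwoFull θ) =
      1 / 4 * Real.sin (3 * θ) ^ 2 + 3 / 4 * Real.cos θ ^ 2 := by
  simp [winProb, sum_question_prod, condWinProb_rotation, catDog]
  ring

theorem cos_sq_pi_div_eight : Real.cos (Real.pi / 8) ^ 2 = 1 / 2 + √2 / 4 := by
  rw [Real.cos_sq, show 2 * (Real.pi / 8) = Real.pi / 4 by ring, Real.cos_pi_div_four]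
  ring

theorem sin_sq_three_mul_pi_div_eight :
    Real.sin (3 * (Real.pi / 8)) ^ 2 = Real.cos (Real.pi / 8) ^ 2 := by
  rw [show 3 * (Real.pi / 8) = Real.pi / 2 - Real.pi / 8 by ring, Real.sin_pi_div_two_sub]

theorem winProb_pi_div_eight :
    winProb maxEntangled (playerOneFull (Real.pi / 8)) (playerTwoFull (Real.pi / 8)) =
      Real.cos (Real.pi / 8) ^ 2 := by
  rw [winProb_rotation, sin_sq_three_mul_pi_div_eight]
  ring

theorem winProb_le_winProb_pi_div_eight (σ τ : Question → QStrategy) :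
    winProb maxEntangled σ τ ≤
      winProb maxEntangled (playerOneFull (Real.pi / 8)) (playerTwoFull (Real.pi / 8)) := by
  rw [winProb_pi_div_eight, cos_sq_pi_div_eight]
  exact winProb_maxEntangled_le σ τ

/-! ### Games and equilibria -/

/-- A profile that maximizes both payoffs is a Pareto optimal Nash equilibrium. -/
theorem Game.isNash_and_isParetoOptimal_of_forall_le {S₁ S₂ : Type*} {G : Game S₁ S₂}
    {s : S₁} {t : S₂} (h₁ : ∀ s' t', G.payoff₁ s' t' ≤ G.payoff₁ s t)
    (h₂ : ∀ s' t', G.payoff₂ s' t' ≤ G.payoff₂ s t) :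
    G.IsNash s t ∧ G.IsParetoOptimal s t := by
  refine ⟨⟨fun s' => h₁ s' t, fun t' => h₂ s t'⟩, ?_⟩
  rintro ⟨s', t', -, -, h | h⟩
  · exact absurd h (h₁ s' t').not_gt
  · exact absurd h (h₂ s' t').not_gt

theorem sum_mul_le_of_mem_stdSimplex {ι : Type*} [Fintype ι] {μ f : ι → ℝ} {c : ℝ}
    (hμ : μ ∈ stdSimplex ℝ ι) (hf : ∀ i, f i ≤ c) : ∑ i, μ i * f i ≤ c :=
  calc ∑ i, μ i * f i ≤ ∑ i, μ i * c :=
        Finset.sum_le_sum fun i _ => mul_le_mul_of_nonneg_left (hf i) (hμ.1 i)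
    _ = c := by rw [← Finset.sum_mul, hμ.2, one_mul]

/-- The three agreement conditions force equal answers on cat/cat, so at most three of the four
question pairs are won. -/
theorem catDog_sharp_payoff₁_le (F₁ F₂ : Question → Face) :
    catDog.sharp.payoff₁ F₁ F₂ ≤ 3 / 4 := by
  have h : ∀ s : Face, s = 0 ∨ s = 1 := by decide
  simp only [PrivateGame.sharp, sum_question_prod, catDog, Wins]
  rcases h (F₁ .cat) with h₁ | h₁ <;> rcases h (F₁ .dog) with h₂ | h₂ <;>
    rcases h (F₂ .cat) with h₃ | h₃ <;> rcases h (F₂ .dog) with h₄ | h₄ <;>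
    simp [h₁, h₂, h₃, h₄] <;> norm_num

theorem catDog_sharp_payoff₂_le (F₁ F₂ : Question → Face) :
    catDog.sharp.payoff₂ F₁ F₂ ≤ 3 / 4 :=
  catDog_sharp_payoff₁_le F₁ F₂

end QGame

theorem mainTheorem5 :
    -- the common payoff at the profile with parameter `θ`, and its maximum over `θ`
    (∀ θ : ℝ,
      (catDog.quantum maxEntangled).sharp.payoff₁ (playerOneFull θ) (playerTwoFull θ) =
          1 / 4 * Real.sin (3 * θ) ^ 2 + 3 / 4 * Real.cos θ ^ 2 ∧
        (catDog.quantum maxEntangled).sharp.payoff₂ (playerOneFull θ) (playerTwoFull θ) =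
          1 / 4 * Real.sin (3 * θ) ^ 2 + 3 / 4 * Real.cos θ ^ 2 ∧
        1 / 4 * Real.sin (3 * θ) ^ 2 + 3 / 4 * Real.cos θ ^ 2 ≤
          1 / 4 * Real.sin (3 * (Real.pi / 8)) ^ 2 + 3 / 4 * Real.cos (Real.pi / 8) ^ 2) ∧
    -- Pareto optimal equilibrium of the game restricted to special unitary matrices
    ((catDog.quantumSpecial maxEntangled).sharp.IsNash (playerOne (Real.pi / 8)) (playerTwo (Real.pi / 8)) ∧
      (catDog.quantumSpecial maxEntangled).sharp.IsParetoOptimal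
        (playerOne (Real.pi / 8)) (playerTwo (Real.pi / 8))) ∧
    -- Pareto optimal equilibrium of the full quantum game
    ((catDog.quantum maxEntangled).sharp.IsNash
        (playerOneFull (Real.pi / 8)) (playerTwoFull (Real.pi / 8)) ∧
      (catDog.quantum maxEntangled).sharp.IsParetoOptimal
        (playerOneFull (Real.pi / 8)) (playerTwoFull (Real.pi / 8))) ∧
    -- winning probability, overall and conditionally on every question pair
    winProb maxEntangled (playerOneFull (Real.pi / 8)) (playerTwoFull (Real.pi / 8)) =
      Real.cos (Real.pi / 8) ^ 2 ∧
    (∀ a b : Question,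
      condWinProb maxEntangled (playerOneFull (Real.pi / 8)) (playerTwoFull (Real.pi / 8)) a b =
        Real.cos (Real.pi / 8) ^ 2) ∧
    |Real.cos (Real.pi / 8) ^ 2 - 0.85| < 0.005 ∧
    -- classical correlated equilibria
    (∀ μ : (Question → Face) × (Question → Face) → ℝ,
      catDog.sharp.IsCorrelatedEquilibrium μ →
        catDog.sharp.expectedPayoff₁ μ ≤ 3 / 4 ∧ catDog.sharp.expectedPayoff₂ μ ≤ 3 / 4) := by
  refine ⟨fun θ => ⟨?_, ?_, ?_⟩, ?_, ?_, winProb_pi_div_eight, fun a b => ?_, ?_, fun μ hμ => ?_⟩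
  · rw [sharp_quantum_payoff₁, winProb_rotation]
  · rw [sharp_quantum_payoff₂, winProb_rotation]
  · rw [← winProb_rotation, ← winProb_rotation]
    exact winProb_le_winProb_pi_div_eight _ _
  · refine Game.isNash_and_isParetoOptimal_of_forall_le (fun σ τ => ?_) fun σ τ => ?_
    · change (catDog.quantum maxEntangled).sharp.payoff₁ (fun a => .ofSpecial (σ a))
        (fun b => .ofSpecial (τ b)) ≤ (catDog.quantum maxEntangled).sharp.payoff₁
          (playerOneFull (Real.pi / 8)) (playerTwoFull (Real.pi / 8))
      simpa only [sharp_quantum_payoff₁] using winProb_le_winProb_pi_div_eight _ _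
    · change (catDog.quantum maxEntangled).sharp.payoff₂ (fun a => .ofSpecial (σ a))
        (fun b => .ofSpecial (τ b)) ≤ (catDog.quantum maxEntangled).sharp.payoff₂
          (playerOneFull (Real.pi / 8)) (playerTwoFull (Real.pi / 8))
      simpa only [sharp_quantum_payoff₂] using winProb_le_winProb_pi_div_eight _ _
  · refine Game.isNash_and_isParetoOptimal_of_forall_le (fun σ τ => ?_) fun σ τ => ?_
    · simpa only [sharp_quantum_payoff₁] using winProb_le_winProb_pi_div_eight σ τ
    · simpa only [sharp_quantum_payoff₂] using winProb_le_winProb_pi_div_eight σ τ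
  · rw [condWinProb_rotation, sin_sq_three_mul_pi_div_eight, ite_self]
  · rw [cos_sq_pi_div_eight, abs_lt]
    have h₁ : 1.41 < √2 := Real.lt_sqrt_of_sq_lt (by norm_num)
    have h₂ : √2 < 1.415 := (Real.sqrt_lt' (by norm_num)).mpr (by norm_num)
    constructor <;> linarith
  -- Only the fact that `μ` is a probability distribution matters, not its incentive constraints.
  · exact ⟨sum_mul_le_of_mem_stdSimplex hμ.1 fun p => catDog_sharp_payoff₁_le p.1 p.2,
      sum_mul_le_of_mem_stdSimplex hμ.1 fun p => catDog_sharp_payoff₂_le p.1 p.2⟩
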